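/- Let $G$ be a finite, connected, regular simple graph with vertex set $V$, $|V|\ge 2$. Let $X$ be the lazy simple random walk on $G$, with transition matrix $P(x,x)=\tfrac12$, $P(x,y)=\tfrac{1}{2\deg(x)}$ if $\{x,y\}\in E(G)$, and $P(x,y)=0$ otherwise. Let $\tau_{\mathrm{cov}}$ be the first time $t\ge 0$ such that $\{X_0,\dots,X_t\}=V$, and let $t_{\mathrm{cov}}(G)=\max_{x\in V}\mathbf E_x[\tau_{\mathrm{cov}}]$. The lamplighter walk on $\mathbf Z_2\wr G$ is the Markov chain on the pairs $(f,x)$, $f\colon V\to\{0,1\}$, $x\in V$, which moves from $(f,x)$ by choosing $y$ according to $P(x,\cdot)$, moving to $y$, and resetting the values $f_x$ and $f_y$ to independent uniform values in $\{0,1\}$ (one uniform value if $y=x$), all other values of $f$ being kept. Let $P^\diamond$ be its transition matrix, let $\pi^\diamond(f,x)=2^{-|V|}\deg(x)/\sum_{v}\deg(v)$, and let $$t_{\mathrm{mix}}(\mathbf Z_2\wr G)=\min\Big\{t\ge 0:\ \max_{(f,x)}\big\|(P^\diamond)^t((f,x),\cdot)-\pi^\diamond\big\|_{\mathrm{TV}}\le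 \tfrac14\Big\},\qquad \|\mu-\nu\|_{\mathrm{TV}}=\max_A|\mu(A)-\nu(A)| .$$ Then $\pi^\diamond$ is a stationary distribution of the lamplighter walk, $t_{\mathrm{cov}}(G)<\infty$, and $t_{\mathrm{mix}}(\mathbf Z_2\wr G)$ is comparable to $t_{\mathrm{cov}}(G)$ up to universal constants, namely $$c_2\, t_{\mathrm{cov}}(G)\ \le\ t_{\mathrm{mix}}(\mathbf Z_2\wr G)\ \le\ C_2\, t_{\mathrm{cov}}(G)\qquad\text{with } c_2=\tfrac1{12},\ C_2=18 .$$ -/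

import Mathlib

open scoped ENNReal

noncomputable section

namespace Lamplighter

section General

variable {S : Type*} [Fintype S] [DecidableEq S]

/-- Total variation distance `max_A |μ(A) - ν(A)|` of two mass functions on a finite set. -/
def tvDist (μ ν : S → ℝ) : ℝ :=
  ⨆ A : Finset S, |∑ a ∈ A, μ a - ∑ a ∈ A, ν a|

/-- `π` is a stationary distribution of the transition matrix `P`: a probability vector with
`π P = π`. -/
def IsStationary (P : Matrix S S ℝ) (π : S → ℝ) : Prop :=
  (∀ x, 0 ≤ π x) ∧ ∑ x, π x = 1 ∧ Matrix.vecMul π P = π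

/-- `d(t) = max_x ‖P^t(x, ·) - π‖_TV`. -/
def mixDist (P : Matrix S S ℝ) (π : S → ℝ) (t : ℕ) : ℝ :=
  ⨆ x : S, tvDist ((P ^ t) x) π

/-- The `ε`-mixing time `min {t ≥ 0 : d(t) ≤ ε}`, equal to `⊤` if there is no such `t`. -/
def mixingTime (P : Matrix S S ℝ) (π : S → ℝ) (ε : ℝ) : ℕ∞ :=
  ⨅ (t : ℕ) (_ : mixDist P π t ≤ ε), (t : ℕ∞)

/-- One step of the chain from `x`: the probability measure with mass `P x y` at `y`. -/
def stepMeasure [MeasurableSpace S] (P : Matrix S S ℝ) (x : S) : MeasureTheory.Measure S :=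
  ∑ y, ENNReal.ofReal (P x y) • MeasureTheory.Measure.dirac y

lemma isProbabilityMeasure_stepMeasure [MeasurableSpace S] {P : Matrix S S ℝ}
    (hP : P ∈ Matrix.rowStochastic ℝ S) (x : S) :
    MeasureTheory.IsProbabilityMeasure (stepMeasure P x) := by
  constructor
  rw [stepMeasure, MeasureTheory.Measure.coe_finsetSum, Finset.sum_apply]
  simp only [MeasureTheory.Measure.smul_apply, MeasureTheory.measure_univ, smul_eq_mul, mul_one]
  rw [← ENNReal.ofReal_sum_of_nonneg (fun y _ => hP.1 x y),
    Matrix.sum_row_of_mem_rowStochastic hP, ENNReal.ofReal_one]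

/-- The transition matrix as a kernel from the history `(X_0, …, X_n)` to `X_{n+1}`; it depends on
`X_n` only. -/
def stepKernel [MeasurableSpace S] [DiscreteMeasurableSpace S] (P : Matrix S S ℝ) (n : ℕ) :
    ProbabilityTheory.Kernel (Finset.Iic n → S) S where
  toFun h := stepMeasure P (h ⟨n, Finset.mem_Iic.2 le_rfl⟩)
  measurable' := (Measurable.of_discrete (f := stepMeasure P)).comp (measurable_pi_apply _)

/-- The law `P_x` on trajectories `ℕ → S` of the Markov chain with transition matrix `P` started
at `x`. -/
def pathLaw [MeasurableSpace S] [DiscreteMeasurableSpace S] (P : Matrix S S ℝ)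
    (hP : P ∈ Matrix.rowStochastic ℝ S) (x : S) : MeasureTheory.Measure (ℕ → S) :=
  haveI : ∀ n, ProbabilityTheory.IsMarkovKernel (stepKernel P n) :=
    fun _ => ⟨fun _ => isProbabilityMeasure_stepMeasure hP _⟩
  ProbabilityTheory.Kernel.traj (X := fun _ : ℕ => S) (fun n => stepKernel P n) 0 (fun _ => x)

/-- The first time by which a trajectory has visited every state (`⊤` if there is none). -/
def coverStep (ω : ℕ → S) : ℕ∞ :=
  ⨅ (t : ℕ) (_ : ∀ v : S, ∃ s ≤ t, ω s = v), (t : ℕ∞)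

/-- The cover time `max_x E_x[τ_cov]`. -/
def coverTime (P : Matrix S S ℝ) (hP : P ∈ Matrix.rowStochastic ℝ S) : ℝ≥0∞ :=
  letI : MeasurableSpace S := ⊤
  haveI : DiscreteMeasurableSpace S := ⟨fun _ => trivial⟩
  ⨆ x : S, ∫⁻ ω, (coverStep ω : ℝ≥0∞) ∂(pathLaw P hP x)

/-- The lamplighter walk over the base chain `P`, on pairs (lamp configuration, position): from
`(f, x)` choose `y` according to `P x`, then set the lamps at `x` and at `y` to independent
uniform values `a` and `b`. -/
def lampMatrix (P : Matrix S S ℝ) : Matrix ((S → ZMod 2) × S) ((S → ZMod 2) × S) ℝ :=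
  fun p q => P p.2 q.2 * ∑ a : ZMod 2, ∑ b : ZMod 2,
    if q.1 = Function.update (Function.update p.1 p.2 a) q.2 b then 1 / 4 else 0

/-- The product of the uniform law on lamp configurations with the law `π` on positions. -/
def lampDist (π : S → ℝ) : (S → ZMod 2) × S → ℝ :=
  fun p => π p.2 * (2 ^ Fintype.card S)⁻¹

end General

section Graph

variable {V : Type*} [Fintype V] [DecidableEq V] (G : SimpleGraph V) [DecidableRel G.Adj]

/-- Transition matrix of the lazy simple random walk on `G`. -/
def lazyWalk : Matrix V V ℝ :=
  fun x y => if x = y then 1 / 2 else if G.Adj x y then 1 / (2 * (G.degree x : ℝ)) else 0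

lemma lazyWalk_mem [Nontrivial V] {G : SimpleGraph V} [DecidableRel G.Adj] (hG : G.Connected) :
    lazyWalk G ∈ Matrix.rowStochastic ℝ V := by
  rw [Matrix.mem_rowStochastic_iff_sum]
  refine ⟨fun x y => ?_, fun x => ?_⟩
  · unfold lazyWalk
    split_ifs <;> positivity
  · have hd : (G.degree x : ℝ) ≠ 0 := by
      exact_mod_cast (hG.preconnected.degree_pos_of_nontrivial x).ne'
    have h : ∀ y, lazyWalk G x y =
        (if x = y then 1 / 2 else 0) + if G.Adj x y then 1 / (2 * (G.degree x : ℝ)) else 0 := by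
      intro y
      unfold lazyWalk
      by_cases hxy : x = y
      · subst hxy
        simp
      · simp [hxy]
    simp only [h, Finset.sum_add_distrib, Finset.sum_ite_eq, Finset.mem_univ, if_true]
    rw [← Finset.sum_filter, ← SimpleGraph.neighborFinset_eq_filter, Finset.sum_const,
      SimpleGraph.card_neighborFinset_eq_degree, nsmul_eq_mul]
    field_simp
    norm_num

/-- The stationary distribution `x ↦ deg x / ∑ deg` of the lazy walk. -/
def degreeDist : V → ℝ :=
  fun x => (G.degree x : ℝ) / ∑ v, (G.degree v : ℝ)

end Graph

end Lamplighter

end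

/-! Conditionally on the trajectory of the base walk up to a time t ≥ 1, the lamps at visited
vertices are independent uniform and the others are untouched. Hence a power of the lamplighter
matrix mixes `lampRefresh A` over the law of (visited set A, position), see `lampMatrix_pow_succ`.
Regularity makes all matrices symmetric and the stationary laws uniform. Let C be the cover time and
n the number of vertices.

Upper bound: the distance to stationarity is at most P(τ > t) plus the ℓ¹ distance of P^t(x, ·) from
uniform. The first term is at most C/(t+1) by Markov. For the second, hitting times are at most C,
so the equation h = 1 + Ph - n 1_y for the expected hitting time of y gives n ∑_{s<T} P^s(y,y) ≤ T +
C. Laziness makes return probabilities decrease, and Cauchy–Schwarz bounds the squared ℓ¹ distance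
by C/(2t).

Lower bound: if t is the mixing time, Cauchy–Schwarz on the overlap of two rows bounds all entries
of the 2t-th power below by a quarter of uniform. Going from all lamps 0 to all lamps 1 forces
covering, so the walk covers by time 2t with probability at least 1/4 from any start. Restarting
every 2t steps gives C ≤ 8t. -/

noncomputable section

namespace Lamplighter

/-! ### The visited-set chain, and the cover time as a sum of tail probabilities -/

section Visits

open MeasureTheory ProbabilityTheory Preorder

variable {S : Type*} [Fintype S] [DecidableEq S]

/-- Transition matrix of the pair (set of visited states, current state) of the chain `P`. -/
def visitMatrix (P : Matrix S S ℝ) : Matrix (Finset S × S) (Finset S × S) ℝ :=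
  fun p q => if q.1 = insert q.2 p.1 then P p.2 q.2 else 0

lemma visitMatrix_nonneg {P : Matrix S S ℝ} (hP : ∀ x y, 0 ≤ P x y) (p q : Finset S × S) :
    0 ≤ visitMatrix P p q := by
  unfold visitMatrix
  split_ifs
  exacts [hP _ _, le_rfl]

lemma visitMatrix_pow_nonneg {P : Matrix S S ℝ} (hP : ∀ x y, 0 ≤ P x y) (t : ℕ)
    (p q : Finset S × S) : 0 ≤ (visitMatrix P ^ t) p q := by
  induction t generalizing q with
  | zero => rw [pow_zero, Matrix.one_apply]; split_ifs <;> norm_num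
  | succ t ih =>
    rw [pow_succ, Matrix.mul_apply]
    exact Finset.sum_nonneg fun r _ => mul_nonneg (ih r) (visitMatrix_nonneg hP r q)

lemma sum_visitMatrix_mul (P : Matrix S S ℝ) (p : Finset S × S) (F : Finset S × S → ℝ) :
    ∑ q, visitMatrix P p q * F q = ∑ y, P p.2 y * F (insert y p.1, y) := by
  rw [Fintype.sum_prod_type_right]
  refine Finset.sum_congr rfl fun y _ => ?_
  simp [visitMatrix, ite_mul]

lemma sum_ofReal_visitMatrix_mul (P : Matrix S S ℝ) (p : Finset S × S) (F : Finset S × S → ℝ≥0∞) :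
    ∑ q, ENNReal.ofReal (visitMatrix P p q) * F q =
      ∑ y, ENNReal.ofReal (P p.2 y) * F (insert y p.1, y) := by
  rw [Fintype.sum_prod_type_right]
  refine Finset.sum_congr rfl fun y _ => ?_
  simp [visitMatrix, apply_ite ENNReal.ofReal, ite_mul]

/-- The probability that the chain started at `x` has not completed the set `A` to the whole state
space at time `t`. -/
def uncovered (P : Matrix S S ℝ) (t : ℕ) (A : Finset S) (x : S) : ℝ :=
  ∑ q : Finset S × S, (visitMatrix P ^ t) (A, x) q * if q.1 = Finset.univ then 0 else 1

lemma lintegral_stepMeasure [MeasurableSpace S] [DiscreteMeasurableSpace S] (P : Matrix S S ℝ)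
    (x : S) (F : S → ℝ≥0∞) :
    ∫⁻ y, F y ∂stepMeasure P x = ∑ y, ENNReal.ofReal (P x y) * F y := by
  simp [stepMeasure, lintegral_finsetSum_measure]

lemma image_IicProdIoc_piSingleton [MeasurableSpace S] (t : ℕ) (h : Finset.Iic t → S) (y : S) :
    Finset.univ.image (IicProdIoc (X := fun _ : ℕ => S) t (t + 1)
      (h, MeasurableEquiv.piSingleton (X := fun _ : ℕ => S) t y)) =
      insert y (Finset.univ.image h) := by
  ext z
  simp only [Finset.mem_image, Finset.mem_univ, true_and, Finset.mem_insert]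
  constructor
  · rintro ⟨⟨i, hi⟩, rfl⟩
    by_cases hit : i ≤ t
    · exact .inr ⟨⟨i, Finset.mem_Iic.2 hit⟩, by simp [IicProdIoc, hit]⟩
    · obtain rfl : i = t + 1 := le_antisymm (Finset.mem_Iic.1 hi) (not_le.1 hit)
      exact .inl (by simp [IicProdIoc, MeasurableEquiv.piSingleton])
  · rintro (rfl | ⟨⟨i, hi⟩, rfl⟩)
    · exact ⟨⟨t + 1, Finset.mem_Iic.2 le_rfl⟩, by
        simp [IicProdIoc, MeasurableEquiv.piSingleton]⟩
    · exact ⟨⟨i, Finset.mem_Iic.2 ((Finset.mem_Iic.1 hi).trans t.le_succ)⟩, by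
        simp [IicProdIoc, Finset.mem_Iic.1 hi]⟩

/-- The pair (visited set, current state) is itself Markov, so its law is a row of a matrix power.
This carries the trajectory measure over to finite sums. -/
lemma lintegral_partialTraj_visited [MeasurableSpace S] [DiscreteMeasurableSpace S]
    (P : Matrix S S ℝ) (hP : P ∈ Matrix.rowStochastic ℝ S) (x : S) (t : ℕ)
    (F : Finset S × S → ℝ≥0∞) :
    ∫⁻ h, F (Finset.univ.image h, h ⟨t, Finset.mem_Iic.2 le_rfl⟩)
        ∂(Kernel.partialTraj (X := fun _ : ℕ => S) (fun n => stepKernel P n) 0 t (fun _ => x)) =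
      ∑ q, ENNReal.ofReal ((visitMatrix P ^ t) ({x}, x) q) * F q := by
  have : ∀ n, IsMarkovKernel (stepKernel P n) :=
    fun _ => ⟨fun _ => isProbabilityMeasure_stepMeasure hP _⟩
  induction t generalizing F with
  | zero =>
    rw [Kernel.partialTraj_self, Kernel.id_apply, lintegral_dirac]
    have : (Finset.univ.image fun _ : Finset.Iic 0 => x) = {x} := by
      ext z
      simp [eq_comm]
    rw [this, Finset.sum_eq_single ({x}, x)]
    · simp
    · intro q _ hq
      simp [hq.symm]
    · simp
  | succ t ih =>
    have := fun n => Kernel.IsMarkovKernel.map (stepKernel P n)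
      (MeasurableEquiv.piSingleton (X := fun _ : ℕ => S) n).measurable
    rw [Kernel.partialTraj_succ_of_le (Nat.zero_le t), Kernel.lintegral_map _ (by fun_prop) _
      .of_discrete, Kernel.lintegral_comp _ _ _ .of_discrete]
    have hstep : ∀ h : Finset.Iic t → S,
        ∫⁻ z, F (Finset.univ.image (IicProdIoc (X := fun _ : ℕ => S) t (t + 1) z),
          IicProdIoc (X := fun _ : ℕ => S) t (t + 1) z ⟨t + 1, Finset.mem_Iic.2 le_rfl⟩)
          ∂(Kernel.id ×ₖ ((stepKernel P t).map
            (MeasurableEquiv.piSingleton (X := fun _ : ℕ => S) t))) h =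
        (fun p : Finset S × S => ∑ y, ENNReal.ofReal (P p.2 y) * F (insert y p.1, y))
          (Finset.univ.image h, h ⟨t, Finset.mem_Iic.2 le_rfl⟩) := by
      intro h
      rw [Kernel.lintegral_id_prod .of_discrete, Kernel.lintegral_map _ (by fun_prop) _ .of_discrete]
      change ∫⁻ y, _ ∂stepMeasure P _ = _
      rw [lintegral_stepMeasure]
      refine Finset.sum_congr rfl fun y _ => ?_
      rw [image_IicProdIoc_piSingleton]
      congr 3
      simp [IicProdIoc, MeasurableEquiv.piSingleton]
    rw [lintegral_congr hstep, ih (fun p : Finset S × S =>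
      ∑ y, ENNReal.ofReal (P p.2 y) * F (insert y p.1, y)), pow_succ]
    have hR := visitMatrix_nonneg hP.1
    have hRt := visitMatrix_pow_nonneg hP.1 t
    calc ∑ q, ENNReal.ofReal ((visitMatrix P ^ t) ({x}, x) q) *
          ∑ y, ENNReal.ofReal (P q.2 y) * F (insert y q.1, y)
        = ∑ r, ∑ q, ENNReal.ofReal ((visitMatrix P ^ t) ({x}, x) r) *
            (ENNReal.ofReal (visitMatrix P r q) * F q) := by
          simp_rw [← sum_ofReal_visitMatrix_mul, Finset.mul_sum]
      _ = ∑ q, ENNReal.ofReal ((visitMatrix P ^ t * visitMatrix P) ({x}, x) q) * F q := by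
          rw [Finset.sum_comm]
          refine Finset.sum_congr rfl fun q _ => ?_
          rw [Matrix.mul_apply, ENNReal.ofReal_sum_of_nonneg
            fun r _ => mul_nonneg (hRt _ _) (hR _ _), Finset.sum_mul]
          refine Finset.sum_congr rfl fun r _ => ?_
          rw [ENNReal.ofReal_mul (hRt _ _), mul_assoc]

/-- The states visited by a trajectory up to time `t`. -/
def visited (t : ℕ) (ω : ℕ → S) : Finset S := Finset.univ.image (frestrictLe (π := fun _ => S) t ω)

lemma mem_visited {t : ℕ} {ω : ℕ → S} {v : S} : v ∈ visited t ω ↔ ∃ s ≤ t, ω s = v := by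
  simp [visited]

lemma lintegral_pathLaw_visited [MeasurableSpace S] [DiscreteMeasurableSpace S]
    (P : Matrix S S ℝ) (hP : P ∈ Matrix.rowStochastic ℝ S) (x : S) (t : ℕ)
    (F : Finset S × S → ℝ≥0∞) :
    ∫⁻ ω, F (visited t ω, ω t) ∂pathLaw P hP x =
      ∑ q, ENNReal.ofReal ((visitMatrix P ^ t) ({x}, x) q) * F q := by
  have : ∀ n, IsMarkovKernel (stepKernel P n) :=
    fun _ => ⟨fun _ => isProbabilityMeasure_stepMeasure hP _⟩
  rw [← lintegral_partialTraj_visited P hP x t F, ← Kernel.traj_map_frestrictLe_apply,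
    lintegral_map .of_discrete (measurable_frestrictLe t)]
  rfl

/-- Layer-cake formula τ = ∑ 1{τ > t}, also valid when τ is infinite. -/
lemma coverStep_eq_tsum (ω : ℕ → S) :
    (coverStep ω : ℝ≥0∞) = ∑' t, if visited t ω = Finset.univ then 0 else 1 := by
  classical
  have hiff : ∀ t, visited t ω = Finset.univ ↔ ∀ v, ∃ s ≤ t, ω s = v := by
    intro t
    simp [Finset.eq_univ_iff_forall, mem_visited]
  simp_rw [hiff]
  by_cases h : ∃ t, ∀ v, ∃ s ≤ t, ω s = v
  · have hN : coverStep ω = (Nat.find h : ℕ∞) := by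
      refine le_antisymm (iInf₂_le _ (Nat.find_spec h)) (le_iInf₂ fun t ht => ?_)
      exact_mod_cast Nat.find_min' h ht
    rw [hN, tsum_eq_sum (s := Finset.range (Nat.find h))]
    · rw [Finset.sum_congr rfl fun t ht => if_neg (Nat.find_min h (Finset.mem_range.1 ht))]
      simp
    · intro t ht
      rw [Finset.mem_range, not_lt] at ht
      refine if_pos fun v => ?_
      obtain ⟨s, hs, hv⟩ := Nat.find_spec h v
      exact ⟨s, hs.trans ht, hv⟩
  · have htop : coverStep ω = ⊤ := by
      refine eq_top_iff.2 (le_iInf₂ fun t ht => ?_)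
      exact absurd ⟨t, ht⟩ h
    rw [htop, tsum_congr fun t => if_neg fun ht => h ⟨t, ht⟩]
    simp

lemma coverTime_eq_iSup_tsum (P : Matrix S S ℝ) (hP : P ∈ Matrix.rowStochastic ℝ S) :
    coverTime P hP = ⨆ x, ∑' t, ENNReal.ofReal (uncovered P t {x} x) := by
  let _ : MeasurableSpace S := ⊤
  have : DiscreteMeasurableSpace S := ⟨fun _ => trivial⟩
  unfold coverTime
  refine iSup_congr fun x => ?_
  simp_rw [coverStep_eq_tsum]
  rw [lintegral_tsum]
  · refine tsum_congr fun t => ?_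
    rw [lintegral_pathLaw_visited P hP x t (fun q => if q.1 = Finset.univ then 0 else 1), uncovered,
      ENNReal.ofReal_sum_of_nonneg]
    · refine Finset.sum_congr rfl fun q _ => ?_
      split_ifs <;> simp
    · intro q _
      have := visitMatrix_pow_nonneg hP.1 t ({x}, x) q
      positivity
  · intro t
    have : Measurable fun h : Finset.Iic t → S =>
      (if Finset.univ.image h = Finset.univ then 0 else 1 : ℝ≥0∞) := .of_discrete
    exact (this.comp (measurable_frestrictLe t)).aemeasurable

end Visits

/-! ### Tails of the cover time and its finiteness -/

section Covering

variable {S : Type*} [Fintype S] [DecidableEq S] {P : Matrix S S ℝ}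

lemma uncovered_zero (A : Finset S) (x : S) :
    uncovered P 0 A x = if A = Finset.univ then 0 else 1 := by
  rw [uncovered, Finset.sum_eq_single (A, x)]
  · simp
  · intro q _ hq
    simp [hq.symm]
  · simp

lemma uncovered_nonneg (hP : ∀ x y, 0 ≤ P x y) (t : ℕ) (A : Finset S) (x : S) :
    0 ≤ uncovered P t A x := by
  refine Finset.sum_nonneg fun q _ => mul_nonneg (visitMatrix_pow_nonneg hP t _ q) ?_
  split_ifs <;> norm_num

lemma uncovered_add (s t : ℕ) (A : Finset S) (x : S) :
    uncovered P (s + t) A x = ∑ q, (visitMatrix P ^ s) (A, x) q * uncovered P t q.1 q.2 := by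
  simp only [uncovered, pow_add, Matrix.mul_apply, Finset.sum_mul, Finset.mul_sum]
  rw [Finset.sum_comm]
  simp only [mul_assoc]

lemma uncovered_succ (t : ℕ) (A : Finset S) (x : S) :
    uncovered P (t + 1) A x = ∑ y, P x y * uncovered P t (insert y A) y := by
  rw [add_comm, uncovered_add, pow_one]
  exact sum_visitMatrix_mul P (A, x) fun q => uncovered P t q.1 q.2

lemma uncovered_univ (t : ℕ) (x : S) : uncovered P t Finset.univ x = 0 := by
  induction t generalizing x with
  | zero => simp [uncovered_zero]
  | succ t ih => simp [uncovered_succ, ih]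

lemma uncovered_anti_set (hP : ∀ x y, 0 ≤ P x y) (t : ℕ) {A B : Finset S} (hAB : A ⊆ B) (x : S) :
    uncovered P t B x ≤ uncovered P t A x := by
  induction t generalizing x A B with
  | zero =>
    rw [uncovered_zero, uncovered_zero]
    split_ifs with hB hA hA
    · rfl
    · norm_num
    · subst hA
      exact absurd (Finset.univ_subset_iff.1 hAB) hB
    · rfl
  | succ t ih =>
    rw [uncovered_succ, uncovered_succ]
    exact Finset.sum_le_sum fun y _ =>
      mul_le_mul_of_nonneg_left (ih (Finset.insert_subset_insert y hAB) y) (hP x y)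

lemma uncovered_antitone (hP : P ∈ Matrix.rowStochastic ℝ S) (A : Finset S) (x : S) :
    Antitone fun t => uncovered P t A x := by
  refine antitone_nat_of_succ_le fun t => ?_
  induction t generalizing A x with
  | zero =>
    calc uncovered P 1 A x = ∑ y, P x y * uncovered P 0 (insert y A) y := uncovered_succ 0 A x
      _ ≤ ∑ y, P x y * uncovered P 0 A x := by
          refine Finset.sum_le_sum fun y _ => mul_le_mul_of_nonneg_left ?_ (hP.1 x y)
          refine (uncovered_anti_set hP.1 0 (Finset.subset_insert y A) y).trans_eq ?_
          rw [uncovered_zero, uncovered_zero]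
      _ = uncovered P 0 A x := by
          rw [← Finset.sum_mul, Matrix.sum_row_of_mem_rowStochastic hP, one_mul]
  | succ t ih =>
    rw [uncovered_succ (t + 1), uncovered_succ t]
    exact Finset.sum_le_sum fun y _ => mul_le_mul_of_nonneg_left (ih _ y) (hP.1 x y)

lemma uncovered_le_one (hP : P ∈ Matrix.rowStochastic ℝ S) (t : ℕ) (A : Finset S) (x : S) :
    uncovered P t A x ≤ 1 := by
  refine (uncovered_antitone hP A x t.zero_le).trans ?_
  simp only [uncovered_zero]
  split_ifs <;> norm_num

/-- The current state always belongs to the visited set. -/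
lemma visitMatrix_pow_eq_zero {A B : Finset S} {x y : S} (hx : x ∈ A) (hy : y ∉ B) (t : ℕ) :
    (visitMatrix P ^ t) (A, x) (B, y) = 0 := by
  cases t with
  | zero =>
    rw [pow_zero, Matrix.one_apply, if_neg]
    rintro ⟨⟩
    exact hy hx
  | succ t =>
    rw [pow_succ, Matrix.mul_apply]
    refine Finset.sum_eq_zero fun r _ => mul_eq_zero_of_right _ (if_neg ?_)
    intro (h : B = insert y r.1)
    exact hy (h ▸ Finset.mem_insert_self _ _)

/-- Markov property at time s: forgetting all visited states but the current one only delays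
covering, and nothing is left to do once covering has occurred. -/
lemma uncovered_add_le (hP : ∀ x y, 0 ≤ P x y) (s t : ℕ) {A : Finset S} {x : S} (hx : x ∈ A) :
    uncovered P (s + t) A x ≤ ∑ q : Finset S × S,
      (visitMatrix P ^ s) (A, x) q * (if q.1 = Finset.univ then 0 else 1) *
        uncovered P t {q.2} q.2 := by
  rw [uncovered_add]
  refine Finset.sum_le_sum fun q _ => ?_
  by_cases hq : q.2 ∈ q.1
  · rw [mul_assoc]
    refine mul_le_mul_of_nonneg_left ?_ (visitMatrix_pow_nonneg hP s _ _)
    split_ifs with h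
    · rw [h, uncovered_univ, zero_mul]
    · rw [one_mul]
      exact uncovered_anti_set hP t (Finset.singleton_subset_iff.2 hq) _
  · have : (visitMatrix P ^ s) (A, x) q = 0 := visitMatrix_pow_eq_zero hx hq s
    simp [this]

/-- If the chain covers the state space by time `N` with probability at least `1 - q` from every
state, then the truncated expectations of the cover time are at most `N / (1 - q)`. -/
lemma sum_uncovered_le (hP : P ∈ Matrix.rowStochastic ℝ S) {N : ℕ} {q : ℝ} (hq : q < 1)
    (hN : ∀ x, uncovered P N {x} x ≤ q) (T : ℕ) (x : S) :
    ∑ t ∈ Finset.range T, uncovered P t {x} x ≤ N / (1 - q) := by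
  have : Nonempty S := ⟨x⟩
  -- The worst start controls every restart at time N, giving M ≤ N + qM. Truncation at T keeps M
  -- finite, so this can be solved without knowing summability.
  obtain ⟨x₀, hx₀⟩ := Finite.exists_max fun x => ∑ t ∈ Finset.range T, uncovered P t {x} x
  refine (hx₀ x).trans ?_
  set M := ∑ t ∈ Finset.range T, uncovered P t {x₀} x₀ with hM
  have hM0 : 0 ≤ M := Finset.sum_nonneg fun t _ => uncovered_nonneg hP.1 t _ _
  have h₁ : M ≤ N + q * M := by
    calc M ≤ ∑ t ∈ Finset.range (N + T), uncovered P t {x₀} x₀ :=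
          Finset.sum_le_sum_of_subset_of_nonneg
            (Finset.range_subset_range.2 (Nat.le_add_left T N))
            fun t _ _ => uncovered_nonneg hP.1 t _ _
      _ = ∑ t ∈ Finset.range N, uncovered P t {x₀} x₀ +
            ∑ t ∈ Finset.range T, uncovered P (N + t) {x₀} x₀ := Finset.sum_range_add _ N T
      _ ≤ N + uncovered P N {x₀} x₀ * M := by
          refine add_le_add ?_ ?_
          · refine (Finset.sum_le_sum fun t _ => uncovered_le_one hP t _ _).trans_eq ?_
            simp
          · refine (Finset.sum_le_sum fun t _ =>
              uncovered_add_le hP.1 N t (Finset.mem_singleton_self x₀)).trans ?_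
            rw [Finset.sum_comm, uncovered, Finset.sum_mul]
            refine Finset.sum_le_sum fun r _ => ?_
            rw [← Finset.mul_sum]
            refine mul_le_mul_of_nonneg_left (hx₀ r.2)
              (mul_nonneg (visitMatrix_pow_nonneg hP.1 N _ _) ?_)
            split_ifs <;> norm_num
      _ ≤ N + q * M := by gcongr; exact hN x₀
  rw [le_div_iff₀ (by linarith)]
  linarith

lemma exists_uncovered_lt_one (hP : P ∈ Matrix.rowStochastic ℝ S)
    (hirr : ∀ x y, Relation.ReflTransGen (fun a b => 0 < P a b) x y) (A : Finset S) (x : S)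
    (hx : x ∈ A) : ∃ t, uncovered P t A x < 1 := by
  induction hn : (Finset.univ \ A).card using Nat.strong_induction_on generalizing A x with
  | _ n ih =>
    by_cases hA : A = Finset.univ
    · exact ⟨0, by simp [uncovered_zero, hA]⟩
    obtain ⟨y, hy⟩ : ∃ y, y ∉ A := by
      simpa [Finset.eq_univ_iff_forall] using hA
    -- Follow a positive-probability path from x to an unvisited y. The set grows along the way,
    -- hence the general B; at y its complement is strictly smaller than that of A, and the outer
    -- induction applies.
    have hstep : ∀ B, A ⊆ B → x ∈ B → ∃ t, uncovered P t B x < 1 := by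
      refine Relation.ReflTransGen.head_induction_on (hirr x y) ?_ ?_
      · intro B hAB hyB
        refine ih _ ?_ B y hyB rfl
        rw [← hn]
        exact Finset.card_lt_card ⟨Finset.sdiff_subset_sdiff le_rfl hAB,
          fun h => (Finset.mem_sdiff.1 (h (Finset.mem_sdiff.2 ⟨Finset.mem_univ y, hy⟩))).2 hyB⟩
      · intro a b hab _ hb B hAB _
        obtain ⟨t, ht⟩ := hb (insert b B) (hAB.trans (Finset.subset_insert _ _))
          (Finset.mem_insert_self _ _)
        refine ⟨t + 1, ?_⟩
        rw [uncovered_succ, ← Matrix.sum_row_of_mem_rowStochastic hP a]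
        refine Finset.sum_lt_sum (fun z _ => mul_le_of_le_one_right (hP.1 a z)
          (uncovered_le_one hP _ _ _)) ⟨b, Finset.mem_univ b, ?_⟩
        exact mul_lt_of_lt_one_right hab ht
    exact hstep A le_rfl hx

lemma summable_uncovered (hP : P ∈ Matrix.rowStochastic ℝ S)
    (hirr : ∀ x y, Relation.ReflTransGen (fun a b => 0 < P a b) x y) (x : S) :
    Summable fun t => uncovered P t {x} x := by
  have : Nonempty S := ⟨x⟩
  choose T hT using fun x => exists_uncovered_lt_one hP hirr {x} x (Finset.mem_singleton_self x)
  obtain ⟨z, hz⟩ := Finite.exists_max T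
  obtain ⟨w, hw⟩ := Finite.exists_max fun x => uncovered P (T z) {x} x
  have hq : uncovered P (T z) {w} w < 1 :=
    (uncovered_antitone hP {w} w (hz w)).trans_lt (hT w)
  exact summable_of_sum_range_le (fun t => uncovered_nonneg hP.1 t _ _)
    fun n => sum_uncovered_le hP hq hw n x

/-- For an irreducible chain the cover time is finite: it is the largest of the expectations
`∑ t, P_x(τ > t)`. -/
lemma exists_isGreatest_coverTime [Nonempty S] (hP : P ∈ Matrix.rowStochastic ℝ S)
    (hirr : ∀ x y, Relation.ReflTransGen (fun a b => 0 < P a b) x y) :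
    ∃ C : ℝ, IsGreatest (Set.range fun x => ∑' t, uncovered P t {x} x) C ∧
      coverTime P hP = ENNReal.ofReal C := by
  obtain ⟨z, hz⟩ := Finite.exists_max fun x => ∑' t, uncovered P t {x} x
  refine ⟨_, ⟨⟨z, rfl⟩, Set.forall_mem_range.2 hz⟩, ?_⟩
  have h : ∀ x, ∑' t, ENNReal.ofReal (uncovered P t {x} x) =
      ENNReal.ofReal (∑' t, uncovered P t {x} x) := fun x =>
    (ENNReal.ofReal_tsum_of_nonneg (fun t => uncovered_nonneg hP.1 t _ _)
      (summable_uncovered hP hirr x)).symm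
  simp_rw [coverTime_eq_iSup_tsum, h]
  exact le_antisymm (iSup_le fun x => ENNReal.ofReal_le_ofReal (hz x))
    (le_iSup (fun x => ENNReal.ofReal (∑' t, uncovered P t {x} x)) z)

end Covering

/-! ### Lamp configurations given the visited set -/

section Lamps

variable {S : Type*} [Fintype S] [DecidableEq S] {P : Matrix S S ℝ}

/-- The transition probability from `f` to `g` when the lamps in `A` are set to independent uniform
values. -/
def lampRefresh (A : Finset S) (f g : S → ZMod 2) : ℝ :=
  if ∀ v ∉ A, f v = g v then (2 ^ A.card)⁻¹ else 0

lemma lampRefresh_nonneg (A : Finset S) (f g : S → ZMod 2) : 0 ≤ lampRefresh A f g := by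
  unfold lampRefresh
  split_ifs <;> positivity

lemma lampRefresh_comm (A : Finset S) (f g : S → ZMod 2) :
    lampRefresh A f g = lampRefresh A g f := by
  simp only [lampRefresh, eq_comm]

lemma lampRefresh_univ (f g : S → ZMod 2) :
    lampRefresh Finset.univ f g = (2 ^ Fintype.card S)⁻¹ := by
  simp [lampRefresh]

/-- If x ∈ A both values of c contribute equally; otherwise only c = f x does, and the weight
2^{-|A|} is twice 2^{-(|A|+1)}. -/
lemma sum_lampRefresh_update (A : Finset S) (f g : S → ZMod 2) (x : S) :
    ∑ c, lampRefresh A f (Function.update g x c) = 2 * lampRefresh (insert x A) f g := by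
  by_cases hx : x ∈ A
  · have : ∀ c, lampRefresh A f (Function.update g x c) = lampRefresh A f g := by
      intro c
      unfold lampRefresh
      congr 1
      refine propext (forall₂_congr fun v hv => ?_)
      rw [Function.update_of_ne (ne_of_mem_of_not_mem hx hv).symm]
    simp [this, Finset.insert_eq_of_mem hx]
  · rw [Finset.sum_eq_single (f x)]
    · unfold lampRefresh
      have hiff : (∀ v ∉ A, f v = Function.update g x (f x) v) ↔ ∀ v ∉ insert x A, f v = g v := by
        refine ⟨fun h v hv => ?_, fun h v hv => ?_⟩
        · rw [Finset.mem_insert, not_or] at hv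
          simpa [hv.1] using h v hv.2
        · by_cases hvx : v = x
          · simp [hvx]
          · simpa [hvx] using h v (by simp [hvx, hv])
      rw [Finset.card_insert_of_notMem hx]
      simp only [hiff]
      split_ifs
      · rw [pow_succ]
        field_simp
      · simp
    · intro c _ hc
      refine if_neg fun h => hc ?_
      simpa using (h x hx).symm
    · simp

lemma sum_ite_eq_update (f g : S → ZMod 2) (x : S) (r : ℝ) :
    (∑ a, if g = Function.update f x a then r else 0) =
      ∑ c, if f = Function.update g x c then r else 0 := by
  simp only [Function.eq_update_iff, ite_and, Finset.sum_ite_eq, Finset.mem_univ, if_true]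
  simp only [eq_comm]

/-- Resetting a lamp is reversible, so the intermediate h can be generated backwards from g;
`sum_lampRefresh_update` then absorbs the two lamps, its two factors 2 cancelling 1/4. -/
lemma sum_lampRefresh_mul (A : Finset S) (f g : S → ZMod 2) (x y : S) :
    ∑ h, lampRefresh A f h * ∑ a : ZMod 2, ∑ b : ZMod 2,
      (if g = Function.update (Function.update h x a) y b then 1 / 4 else 0) =
        lampRefresh (insert y (insert x A)) f g := by
  calc _ = ∑ h, lampRefresh A f h * ∑ c : ZMod 2, ∑ d : ZMod 2,
        (if h = Function.update (Function.update g y c) x d then 1 / 4 else 0) := by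
        refine Finset.sum_congr rfl fun h _ => ?_
        congr 1
        rw [Finset.sum_congr rfl fun a _ => sum_ite_eq_update (Function.update h x a) g y (1 / 4),
          Finset.sum_comm]
        refine Finset.sum_congr rfl fun c _ => ?_
        rw [← sum_ite_eq_update]
        simp only [eq_comm]
    _ = ∑ c, ∑ d, 1 / 4 * lampRefresh A f (Function.update (Function.update g y c) x d) := by
        simp_rw [Finset.mul_sum]
        rw [Finset.sum_comm]
        refine Finset.sum_congr rfl fun c _ => ?_
        rw [Finset.sum_comm]
        refine Finset.sum_congr rfl fun d _ => ?_
        simp [mul_comm]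
    _ = lampRefresh (insert y (insert x A)) f g := by
        simp_rw [← Finset.mul_sum, sum_lampRefresh_update, ← Finset.mul_sum,
          sum_lampRefresh_update]
        ring

lemma lampMatrix_apply (f g : S → ZMod 2) (x y : S) :
    lampMatrix P (f, x) (g, y) = P x y * lampRefresh {y, x} f g := by
  have h := sum_lampRefresh_mul ∅ f g x y
  rw [Finset.sum_eq_single f] at h
  · rw [lampMatrix, ← insert_empty_eq x, ← h]
    simp [lampRefresh]
  · intro k _ hk
    simp [lampRefresh, ← funext_iff, hk.symm]
  · simp

lemma lampMatrix_isSymm (hP : P.IsSymm) : (lampMatrix P).IsSymm := by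
  ext ⟨f, x⟩ ⟨g, y⟩
  rw [Matrix.transpose_apply, lampMatrix_apply, lampMatrix_apply, hP.apply, lampRefresh_comm,
    Finset.pair_comm]

lemma lampMatrix_mem (hP : P ∈ Matrix.rowStochastic ℝ S) :
    lampMatrix P ∈ Matrix.rowStochastic ℝ ((S → ZMod 2) × S) := by
  rw [Matrix.mem_rowStochastic_iff_sum]
  refine ⟨fun p q => ?_, fun p => ?_⟩
  · rw [show p = (p.1, p.2) from rfl, show q = (q.1, q.2) from rfl, lampMatrix_apply]
    exact mul_nonneg (hP.1 _ _) (lampRefresh_nonneg _ _ _)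
  · rw [Fintype.sum_prod_type_right, ← Matrix.sum_row_of_mem_rowStochastic hP p.2]
    refine Finset.sum_congr rfl fun y _ => ?_
    simp only [lampMatrix]
    rw [← Finset.mul_sum, Finset.sum_comm]
    simp_rw [Finset.sum_comm (s := Finset.univ (α := S → ZMod 2))]
    simp
    norm_num

/-- Fails at time 0, when x counts as visited but its lamp has not been reset. -/
lemma lampMatrix_pow_succ (t : ℕ) (f g : S → ZMod 2) (x y : S) :
    (lampMatrix P ^ (t + 1)) (f, x) (g, y) =
      ∑ A, (visitMatrix P ^ (t + 1)) ({x}, x) (A, y) * lampRefresh A f g := by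
  induction t generalizing g y with
  | zero =>
    rw [zero_add, pow_one, pow_one, lampMatrix_apply]
    simp [visitMatrix]
  | succ t ih =>
    rw [pow_succ, Matrix.mul_apply, Fintype.sum_prod_type_right]
    have hz : ∀ z, ∑ h, (lampMatrix P ^ (t + 1)) (f, x) (h, z) * lampMatrix P (h, z) (g, y) =
        ∑ A, (visitMatrix P ^ (t + 1)) ({x}, x) (A, z) * P z y *
          lampRefresh (insert y A) f g := by
      intro z
      simp_rw [ih, Finset.sum_mul]
      rw [Finset.sum_comm]
      refine Finset.sum_congr rfl fun A _ => ?_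
      -- A step from z also resets the lamp at z, which is redundant because z is already visited.
      by_cases hzA : z ∈ A
      · rw [← Finset.insert_eq_of_mem hzA, ← sum_lampRefresh_mul, Finset.mul_sum,
          Finset.insert_eq_of_mem hzA]
        refine Finset.sum_congr rfl fun h _ => ?_
        simp only [lampMatrix]
        ring
      · simp [visitMatrix_pow_eq_zero (Finset.mem_singleton_self x) hzA]
    simp_rw [hz, pow_succ _ (t + 1), Matrix.mul_apply, Finset.sum_mul]
    rw [Finset.sum_comm (s := Finset.univ (α := Finset S)), Fintype.sum_prod_type_right]
    refine Finset.sum_congr rfl fun z _ => Finset.sum_congr rfl fun A _ => ?_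
    simp [visitMatrix, mul_ite, ite_mul]

lemma le_lampMatrix_pow (hP : P ∈ Matrix.rowStochastic ℝ S) (t : ℕ) (f g : S → ZMod 2) (x y : S) :
    (visitMatrix P ^ (t + 1)) ({x}, x) (Finset.univ, y) * (2 ^ Fintype.card S)⁻¹ ≤
      (lampMatrix P ^ (t + 1)) (f, x) (g, y) := by
  rw [lampMatrix_pow_succ, ← lampRefresh_univ f g]
  exact Finset.single_le_sum (f := fun A => (visitMatrix P ^ (t + 1)) ({x}, x) (A, y) *
    lampRefresh A f g) (fun A _ => mul_nonneg (visitMatrix_pow_nonneg hP.1 _ _ _)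
      (lampRefresh_nonneg _ _ _)) (Finset.mem_univ _)

/-- Every lamp has to change, so only the full visited set contributes. -/
lemma lampMatrix_pow_zero_one (t : ℕ) (x y : S) :
    (lampMatrix P ^ (t + 1)) (0, x) (1, y) =
      (visitMatrix P ^ (t + 1)) ({x}, x) (Finset.univ, y) * (2 ^ Fintype.card S)⁻¹ := by
  rw [lampMatrix_pow_succ, Finset.sum_eq_single Finset.univ, lampRefresh_univ]
  · intro A _ hA
    rw [lampRefresh, if_neg, mul_zero]
    intro h
    exact hA (Finset.eq_univ_iff_forall.2 fun v => by
      by_contra hv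
      simpa using h v hv)
  · simp

lemma sum_visitMatrix_pow (t : ℕ) (A : Finset S) (x y : S) :
    ∑ B, (visitMatrix P ^ t) (A, x) (B, y) = (P ^ t) x y := by
  induction t generalizing y with
  | zero => simp [Matrix.one_apply, ite_and]
  | succ t ih =>
    simp_rw [pow_succ, Matrix.mul_apply]
    rw [Finset.sum_comm, Fintype.sum_prod_type_right]
    refine Finset.sum_congr rfl fun z _ => ?_
    rw [← ih, Finset.sum_mul]
    refine Finset.sum_congr rfl fun B _ => ?_
    rw [← Finset.mul_sum]
    simp [visitMatrix]

lemma visitMatrix_pow_le (hP : ∀ x y, 0 ≤ P x y) (t : ℕ) (A B : Finset S) (x y : S) :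
    (visitMatrix P ^ t) (A, x) (B, y) ≤ (P ^ t) x y := by
  rw [← sum_visitMatrix_pow t A x y]
  exact Finset.single_le_sum (f := fun B => (visitMatrix P ^ t) (A, x) (B, y))
    (fun B _ => visitMatrix_pow_nonneg hP _ _ _) (Finset.mem_univ B)

lemma sum_pow_sub_visitMatrix_pow (t : ℕ) (x : S) :
    ∑ y, ((P ^ t) x y - (visitMatrix P ^ t) ({x}, x) (Finset.univ, y)) =
      uncovered P t {x} x := by
  rw [uncovered, Fintype.sum_prod_type_right]
  refine Finset.sum_congr rfl fun y _ => ?_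
  rw [← sum_visitMatrix_pow t {x} x y,
    ← Finset.add_sum_erase _ _ (Finset.mem_univ (Finset.univ : Finset S)),
    ← Finset.add_sum_erase _ _ (Finset.mem_univ (Finset.univ : Finset S)), add_sub_cancel_left]
  simp only [if_true, mul_zero, zero_add]
  refine Finset.sum_congr rfl fun A hA => ?_
  simp [Finset.ne_of_mem_erase hA]

end Lamps

/-! ### Convergence of a lazy symmetric chain, controlled by its cover time -/

section Mixing

variable {S : Type*} [Fintype S] [DecidableEq S] {P : Matrix S S ℝ}

open Matrix

/-- Jensen in each row; by symmetry the columns also sum to 1. -/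
lemma sum_mulVec_sq_le {Q : Matrix S S ℝ} (hQ : Q ∈ rowStochastic ℝ S) (hs : Q.IsSymm)
    (v : S → ℝ) : ∑ x, (Q *ᵥ v) x ^ 2 ≤ ∑ x, v x ^ 2 := by
  calc ∑ x, (Q *ᵥ v) x ^ 2 ≤ ∑ x, ∑ y, Q x y * v y ^ 2 :=
        Finset.sum_le_sum fun x _ => Real.pow_arith_mean_le_arith_mean_pow_of_even Finset.univ _ v
          (fun y _ => hQ.1 x y) (sum_row_of_mem_rowStochastic hQ x) even_two
    _ = ∑ y, (∑ x, Q y x) * v y ^ 2 := by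
        rw [Finset.sum_comm]
        simp_rw [Finset.sum_mul, hs.apply]
    _ = ∑ y, v y ^ 2 := by simp_rw [sum_row_of_mem_rowStochastic hQ, one_mul]

/-- A lazy symmetric chain is nonnegative definite and contractive in a strong sense. -/
lemma sum_mulVec_sq_le_dotProduct (hP : P ∈ rowStochastic ℝ S) (hs : P.IsSymm)
    (hlazy : ∀ x, 1 / 2 ≤ P x x) (v : S → ℝ) :
    ∑ x, (P *ᵥ v) x ^ 2 ≤ ∑ x, v x * (P *ᵥ v) x := by
  -- Laziness makes 2P - 1 stochastic; expanding its ℓ² contraction gives the claim.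
  have hQ : (2 : ℝ) • P - 1 ∈ rowStochastic ℝ S := by
    rw [mem_rowStochastic_iff_sum]
    refine ⟨fun x y => ?_, fun x => ?_⟩
    · rw [Matrix.sub_apply, Matrix.smul_apply, one_apply, smul_eq_mul]
      split_ifs with h
      · subst h
        linarith [hlazy x]
      · linarith [hP.1 x y]
    · simp only [Matrix.sub_apply, Matrix.smul_apply, smul_eq_mul, Finset.sum_sub_distrib, ← Finset.mul_sum,
        sum_row_of_mem_rowStochastic hP, one_apply]
      simp
      norm_num
  have hQs : ((2 : ℝ) • P - 1).IsSymm := (hs.smul 2).sub isSymm_one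
  have h := sum_mulVec_sq_le hQ hQs v
  have hexp : ∀ x, (((2 : ℝ) • P - 1) *ᵥ v) x ^ 2 =
      4 * (P *ᵥ v) x ^ 2 - 4 * (v x * (P *ᵥ v) x) + v x ^ 2 := by
    intro x
    rw [sub_mulVec, smul_mulVec, one_mulVec, Pi.sub_apply, Pi.smul_apply, smul_eq_mul]
    ring
  simp_rw [hexp, Finset.sum_add_distrib, Finset.sum_sub_distrib, ← Finset.mul_sum] at h
  linarith

lemma dotProduct_mulVec_le_sum_sq (hP : P ∈ rowStochastic ℝ S) (hs : P.IsSymm) (v : S → ℝ) :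
    ∑ x, v x * (P *ᵥ v) x ≤ ∑ x, v x ^ 2 := by
  have h := sum_mulVec_sq_le hP hs v
  have : ∑ x, v x * (P *ᵥ v) x ≤ ∑ x, (v x ^ 2 / 2 + (P *ᵥ v) x ^ 2 / 2) :=
    Finset.sum_le_sum fun x _ => by nlinarith [sq_nonneg (v x - (P *ᵥ v) x)]
  rw [Finset.sum_add_distrib, ← Finset.sum_div, ← Finset.sum_div] at this
  linarith

lemma pow_add_self_apply (hs : P.IsSymm) (s : ℕ) (y : S) :
    (P ^ (s + s)) y y = ∑ z, (P ^ s) z y ^ 2 := by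
  rw [pow_add, mul_apply]
  refine Finset.sum_congr rfl fun z _ => ?_
  rw [sq, (hs.pow s).apply]

/-- With v = P^s e_y, the entries at times 2s, 2s+1, 2s+2 are ‖v‖², ⟨v, Pv⟩ and ‖Pv‖². The first
inequality is contraction; the second needs laziness. -/
lemma pow_diag_antitone (hP : P ∈ rowStochastic ℝ S) (hs : P.IsSymm)
    (hlazy : ∀ x, 1 / 2 ≤ P x x) (y : S) : Antitone fun t => (P ^ t) y y := by
  refine antitone_nat_of_succ_le fun t => ?_
  have hcol : ∀ s z, (P *ᵥ fun w => (P ^ s) w y) z = (P ^ (s + 1)) z y := by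
    intro s z
    rw [pow_succ', mul_apply]
    rfl
  have hodd : ∀ s, (P ^ (2 * s + 1)) y y = ∑ z, (P ^ s) z y * (P ^ (s + 1)) z y := by
    intro s
    rw [two_mul, add_assoc, pow_add, mul_apply]
    exact Finset.sum_congr rfl fun z _ => by rw [(hs.pow s).apply]
  obtain ⟨s, rfl | rfl⟩ := Nat.even_or_odd' t
  · have h := dotProduct_mulVec_le_sum_sq hP hs fun w => (P ^ s) w y
    simp_rw [hcol] at h
    rwa [hodd, two_mul, pow_add_self_apply hs]
  · have h := sum_mulVec_sq_le_dotProduct hP hs hlazy fun w => (P ^ s) w y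
    simp_rw [hcol] at h
    rwa [hodd, show 2 * s + 1 + 1 = (s + 1) + (s + 1) by ring, pow_add_self_apply hs]

/-- The probability that the chain started at `x` has not visited `y` by time `t`. -/
def unhit (P : Matrix S S ℝ) (y : S) : ℕ → S → ℝ
  | 0, x => if x = y then 0 else 1
  | t + 1, x => if x = y then 0 else ∑ z, P x z * unhit P y t z

lemma unhit_self (y : S) (t : ℕ) : unhit P y t y = 0 := by
  cases t <;> simp [unhit]

lemma unhit_nonneg (hP : ∀ x y, 0 ≤ P x y) (y : S) (t : ℕ) (x : S) : 0 ≤ unhit P y t x := by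
  induction t generalizing x with
  | zero => rw [unhit]; split_ifs <;> norm_num
  | succ t ih =>
    rw [unhit]
    split_ifs
    · rfl
    · exact Finset.sum_nonneg fun z _ => mul_nonneg (hP x z) (ih z)

lemma unhit_le_uncovered_of_notMem (hP : ∀ x y, 0 ≤ P x y) {A : Finset S} {y : S} (hy : y ∉ A)
    (t : ℕ) (x : S) : unhit P y t x ≤ uncovered P t A x := by
  induction t generalizing A x with
  | zero =>
    rw [unhit, uncovered_zero, if_neg (ne_of_mem_of_not_mem' (Finset.mem_univ y) hy).symm]
    split_ifs <;> norm_num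
  | succ t ih =>
    rw [unhit]
    split_ifs with hx
    · exact uncovered_nonneg hP _ _ _
    · rw [uncovered_succ]
      refine Finset.sum_le_sum fun z _ => mul_le_mul_of_nonneg_left ?_ (hP x z)
      by_cases hz : z = y
      · rw [hz, unhit_self]
        exact uncovered_nonneg hP _ _ _
      · exact ih (by simp [hy, Ne.symm hz]) z

lemma unhit_le_uncovered (hP : ∀ x y, 0 ≤ P x y) (y : S) (t : ℕ) (x : S) :
    unhit P y t x ≤ uncovered P t {x} x := by
  by_cases hx : x = y
  · rw [hx, unhit_self]
    exact uncovered_nonneg hP _ _ _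
  · exact unhit_le_uncovered_of_notMem hP (by simpa using Ne.symm hx) t x

/-- The expected hitting time `h` of `y` solves `h = 1 + P h - n 1_y`. -/
lemma tsum_unhit_eq (hP : P ∈ rowStochastic ℝ S) (hs : P.IsSymm) (y : S)
    (hsum : ∀ x, Summable fun t => unhit P y t x) :
    (fun x => ∑' t, unhit P y t x) = 1 + P *ᵥ (fun x => ∑' t, unhit P y t x) -
      Pi.single y (Fintype.card S : ℝ) := by
  set h : S → ℝ := fun x => ∑' t, unhit P y t x with hh
  have hy : h y = 0 := by simp [hh, unhit_self]
  have hne : ∀ x, x ≠ y → h x = 1 + (P *ᵥ h) x := by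
    intro x hx
    have h₁ : h x = unhit P y 0 x + ∑' t, unhit P y (t + 1) x := (hsum x).tsum_eq_zero_add
    have h₂ : ∀ t, unhit P y (t + 1) x = ∑ z, P x z * unhit P y t z := fun t => by
      rw [unhit, if_neg hx]
    rw [h₁, unhit, if_neg hx, tsum_congr h₂,
      Summable.tsum_finsetSum fun z _ => (hsum z).mul_left (P x z)]
    simp_rw [tsum_mul_left]
    rfl
  have hcol : ∑ x, (P *ᵥ h) x = ∑ x, h x := by
    simp only [mulVec, dotProduct]
    rw [Finset.sum_comm]
    refine Finset.sum_congr rfl fun z _ => ?_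
    rw [← Finset.sum_mul]
    rw [Finset.sum_congr rfl fun x _ => hs.apply z x, sum_row_of_mem_rowStochastic hP, one_mul]
  -- Kac's formula: 1 + Ph - h sums to n since columns of P sum to 1, and it vanishes off y.
  have hy' : 1 + (P *ᵥ h) y = Fintype.card S := by
    have h₁ : ∑ x, (1 + (P *ᵥ h) x - h x) = 1 + (P *ᵥ h) y := by
      rw [Finset.sum_eq_single y]
      · rw [hy, sub_zero]
      · intro x _ hx
        rw [hne x hx, sub_self]
      · simp
    rw [← h₁, Finset.sum_sub_distrib, Finset.sum_add_distrib, hcol]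
    simp
  funext x
  by_cases hx : x = y
  · subst hx
    simp only [Pi.sub_apply, Pi.add_apply, Pi.one_apply, Pi.single_eq_same]
    rw [hy', hy, sub_self]
  · simp [hne x hx, hx]

lemma pow_mulVec_one (hP : P ∈ rowStochastic ℝ S) (t : ℕ) : P ^ t *ᵥ 1 = 1 :=
  (pow_mem hP t).2

/-- Iterate the equation of `tsum_unhit_eq` T times and evaluate at y, where h vanishes; P^T h ≤ C
because y is hit no later than the space is covered. -/
lemma card_mul_sum_pow_diag_le (hP : P ∈ rowStochastic ℝ S) (hs : P.IsSymm) {C : ℝ}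
    (hsum : ∀ x, Summable fun t => uncovered P t {x} x)
    (hC : ∀ x, ∑' t, uncovered P t {x} x ≤ C) (T : ℕ) (y : S) :
    Fintype.card S * ∑ t ∈ Finset.range T, (P ^ t) y y ≤ T + C := by
  have hsum' : ∀ x, Summable fun t => unhit P y t x := fun x =>
    (hsum x).of_nonneg_of_le (fun t => unhit_nonneg hP.1 y t x)
      fun t => unhit_le_uncovered hP.1 y t x
  have heq := tsum_unhit_eq hP hs y hsum'
  set h : S → ℝ := fun x => ∑' t, unhit P y t x with hh
  have hy : h y = 0 := by simp [hh, unhit_self]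
  have hhC : ∀ x, h x ≤ C := fun x =>
    ((hsum' x).tsum_le_tsum (fun t => unhit_le_uncovered hP.1 y t x) (hsum x)).trans (hC x)
  have hiter : ∀ T : ℕ, h y = T + (P ^ T *ᵥ h) y -
      Fintype.card S * ∑ t ∈ Finset.range T, (P ^ t) y y := by
    intro T
    induction T with
    | zero => simp
    | succ T ih =>
      have h₁ : (P ^ T *ᵥ h) y = 1 + (P ^ (T + 1) *ᵥ h) y - (P ^ T) y y * Fintype.card S := by
        conv_lhs => rw [heq]
        rw [mulVec_sub, mulVec_add, pow_mulVec_one hP, mulVec_mulVec, ← pow_succ]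
        simp
      rw [ih, h₁, Finset.sum_range_succ]
      push_cast
      ring
  have hle : (P ^ T *ᵥ h) y ≤ C := by
    calc (P ^ T *ᵥ h) y ≤ ∑ z, (P ^ T) y z * C :=
          Finset.sum_le_sum fun z _ => mul_le_mul_of_nonneg_left (hhC z) ((pow_mem hP T).1 y z)
      _ = C := by rw [← Finset.sum_mul, sum_row_of_mem_rowStochastic (pow_mem hP T), one_mul]
  linarith [hiter T]

/-- A quantitative convergence theorem for lazy symmetric chains in terms of the cover time. -/
lemma mul_sum_abs_pow_sub_sq_le (hP : P ∈ rowStochastic ℝ S) (hs : P.IsSymm)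
    (hlazy : ∀ x, 1 / 2 ≤ P x x) {C : ℝ}
    (hsum : ∀ x, Summable fun t => uncovered P t {x} x)
    (hC : ∀ x, ∑' t, uncovered P t {x} x ≤ C) (t : ℕ) (x : S) :
    2 * t * (∑ y, |(Fintype.card S : ℝ)⁻¹ - (P ^ t) x y|) ^ 2 ≤ C := by
  have : Nonempty S := ⟨x⟩
  set n : ℝ := (Fintype.card S : ℝ) with hn
  have hn0 : n ≠ 0 := by simp [hn]
  have hnpos : 0 < n := by positivity
  -- Cauchy–Schwarz; symmetry turns ∑ P^t(x,y)² into a return probability.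
  have h₁ : (∑ y, |n⁻¹ - (P ^ t) x y|) ^ 2 ≤ n * (P ^ (t + t)) x x - 1 := by
    calc (∑ y, |n⁻¹ - (P ^ t) x y|) ^ 2 ≤ n * ∑ y, |n⁻¹ - (P ^ t) x y| ^ 2 :=
          sq_sum_le_card_mul_sum_sq
      _ = n * ∑ y, (n⁻¹ ^ 2 - 2 * n⁻¹ * (P ^ t) x y + (P ^ t) y x ^ 2) := by
          congr 1
          refine Finset.sum_congr rfl fun y _ => ?_
          rw [sq_abs, (hs.pow t).apply]
          ring
      _ = n * (P ^ (t + t)) x x - 1 := by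
          rw [Finset.sum_add_distrib, Finset.sum_sub_distrib, ← Finset.mul_sum,
            sum_row_of_mem_rowStochastic (pow_mem hP t), ← pow_add_self_apply hs]
          simp only [Finset.sum_const, Finset.card_univ, nsmul_eq_mul, ← hn]
          field_simp
          ring
  have h₂ : (2 * t : ℝ) * (P ^ (t + t)) x x ≤ ∑ s ∈ Finset.range (t + t), (P ^ s) x x := by
    have := Finset.card_nsmul_le_sum (Finset.range (t + t)) (fun s => (P ^ s) x x)
      ((P ^ (t + t)) x x) fun s hs' => pow_diag_antitone hP hs hlazy x (Finset.mem_range.1 hs').le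
    simpa [two_mul] using this
  have h₃ := card_mul_sum_pow_diag_le hP hs hsum hC (t + t) x
  push_cast at h₃
  calc 2 * t * (∑ y, |n⁻¹ - (P ^ t) x y|) ^ 2 ≤ 2 * t * (n * (P ^ (t + t)) x x - 1) := by gcongr
    _ = n * (2 * t * (P ^ (t + t)) x x) - 2 * t := by ring
    _ ≤ n * ∑ s ∈ Finset.range (t + t), (P ^ s) x x - 2 * t := by gcongr
    _ ≤ C := by linarith

end Mixing

/-! ### Total variation, row overlaps and mixing times -/

section TotalVariation

variable {S : Type*} [Fintype S] [DecidableEq S]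

/-- With equal total masses a one-sided bound suffices: an excess on A is a deficit on its
complement. -/
lemma tvDist_le_of_sub_le {μ ν d : S → ℝ} {ε : ℝ} (hμν : ∑ a, μ a = ∑ a, ν a)
    (hd : ∀ a, 0 ≤ d a) (h : ∀ a, ν a - μ a ≤ d a) (hε : ∑ a, d a ≤ ε) : tvDist μ ν ≤ ε := by
  have key : ∀ A : Finset S, ∑ a ∈ A, ν a - ∑ a ∈ A, μ a ≤ ε := fun A => by
    rw [← Finset.sum_sub_distrib]
    exact (Finset.sum_le_sum fun a _ => h a).trans
      ((Finset.sum_le_univ_sum_of_nonneg hd).trans hε)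
  refine ciSup_le fun A => abs_le.2 ⟨by linarith [key A], ?_⟩
  have h₁ := key Aᶜ
  have h₂ := Finset.sum_add_sum_compl A μ
  have h₃ := Finset.sum_add_sum_compl A ν
  linarith

lemma abs_sum_sub_sum_le_tvDist (μ ν : S → ℝ) (A : Finset S) :
    |∑ a ∈ A, μ a - ∑ a ∈ A, ν a| ≤ tvDist μ ν :=
  le_ciSup (f := fun A : Finset S => |∑ a ∈ A, μ a - ∑ a ∈ A, ν a|) (Set.finite_range _).bddAbove A

lemma tvDist_le_mixDist (M : Matrix S S ℝ) (π : S → ℝ) (t : ℕ) (x : S) :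
    tvDist ((M ^ t) x) π ≤ mixDist M π t :=
  le_ciSup (f := fun x => tvDist ((M ^ t) x) π) (Set.finite_range _).bddAbove x

/-- Compare μ with π where μ ≤ ν, and ν with π on the complement. -/
lemma one_sub_tvDist_le_sum_min (μ ν π : S → ℝ) (hπ : ∑ a, π a = 1) :
    1 - tvDist μ π - tvDist ν π ≤ ∑ a, min (μ a) (ν a) := by
  set A : Finset S := Finset.univ.filter fun a => μ a ≤ ν a
  have hμ := (abs_le.1 (abs_sum_sub_sum_le_tvDist μ π A)).1
  have hν := (abs_le.1 (abs_sum_sub_sum_le_tvDist ν π Aᶜ)).1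
  rw [← Finset.sum_add_sum_compl A] at hπ ⊢
  have h₁ : ∑ a ∈ A, min (μ a) (ν a) = ∑ a ∈ A, μ a :=
    Finset.sum_congr rfl fun a ha => min_eq_left (Finset.mem_filter.1 ha).2
  have h₂ : ∑ a ∈ Aᶜ, min (μ a) (ν a) = ∑ a ∈ Aᶜ, ν a := by
    refine Finset.sum_congr rfl fun a ha => min_eq_right (le_of_not_ge fun h => ?_)
    exact Finset.mem_compl.1 ha (Finset.mem_filter.2 ⟨Finset.mem_univ a, h⟩)
  rw [h₁, h₂]
  linarith

/-- After twice the mixing time, all transition probabilities of a symmetric chain are bounded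
below by a quarter of the uniform ones. -/
lemma le_pow_of_mixDist_le {M : Matrix S S ℝ} (hM : M ∈ Matrix.rowStochastic ℝ S) (hs : M.IsSymm)
    {t : ℕ} (ht : mixDist M (fun _ => (Fintype.card S : ℝ)⁻¹) t ≤ 1 / 4) (x y : S) :
    (Fintype.card S : ℝ)⁻¹ / 4 ≤ (M ^ (t + t)) x y := by
  have : Nonempty S := ⟨x⟩
  have hnpos : (0 : ℝ) < Fintype.card S := by positivity
  have hhalf : 1 / 2 ≤ ∑ z, min ((M ^ t) x z) ((M ^ t) y z) := by
    have h := one_sub_tvDist_le_sum_min ((M ^ t) x) ((M ^ t) y)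
      (fun _ => (Fintype.card S : ℝ)⁻¹) (by simp)
    linarith [tvDist_le_mixDist M (fun _ => (Fintype.card S : ℝ)⁻¹) t x,
      tvDist_le_mixDist M (fun _ => (Fintype.card S : ℝ)⁻¹) t y]
  have hsq : (∑ z, min ((M ^ t) x z) ((M ^ t) y z)) ^ 2 ≤
      Fintype.card S * (M ^ (t + t)) x y := by
    refine sq_sum_le_card_mul_sum_sq.trans ?_
    rw [Finset.card_univ, pow_add, Matrix.mul_apply]
    refine mul_le_mul_of_nonneg_left (Finset.sum_le_sum fun z _ => ?_) hnpos.le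
    have hx := (pow_mem hM t).1 x z
    have hy := (pow_mem hM t).1 y z
    rw [(hs.pow t).apply y z, sq]
    exact mul_le_mul (min_le_left _ _) (min_le_right _ _) (le_min hx hy) hx
  rw [inv_eq_one_div, div_div, div_le_iff₀ (by positivity)]
  nlinarith

lemma exists_mixingTime_eq {M : Matrix S S ℝ} {π : S → ℝ} {ε : ℝ} {t : ℕ}
    (ht : mixDist M π t ≤ ε) :
    ∃ s ≤ t, mixDist M π s ≤ ε ∧ mixingTime M π ε = (s : ℕ∞) := by
  classical
  have h : ∃ t, mixDist M π t ≤ ε := ⟨t, ht⟩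
  refine ⟨Nat.find h, Nat.find_min' h ht, Nat.find_spec h, ?_⟩
  refine le_antisymm (iInf₂_le (Nat.find h) (Nat.find_spec h)) (le_iInf₂ fun t ht => ?_)
  exact_mod_cast Nat.find_min' h ht

lemma isStationary_uniform [Nonempty S] {M : Matrix S S ℝ} (hM : M ∈ Matrix.rowStochastic ℝ S)
    (hs : M.IsSymm) : IsStationary M fun _ => (Fintype.card S : ℝ)⁻¹ := by
  refine ⟨fun _ => by positivity, by simp, funext fun x => ?_⟩
  simp only [Matrix.vecMul, dotProduct]
  rw [← Finset.mul_sum]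
  rw [Finset.sum_congr rfl fun z _ => hs.apply x z, Matrix.sum_row_of_mem_rowStochastic hM, mul_one]

end TotalVariation

/-! ### The two comparisons between lamplighter mixing and covering -/

section LampMixing

variable {S : Type*} [Fintype S] [DecidableEq S] {P : Matrix S S ℝ}

lemma lampDist_uniform :
    lampDist (fun _ : S => (Fintype.card S : ℝ)⁻¹) =
      fun _ => (Fintype.card ((S → ZMod 2) × S) : ℝ)⁻¹ := by
  funext p
  simp [lampDist, mul_comm]

/-- Keeping only trajectories that have covered gives exactly uniform lamps; what is lost is the
uncovered mass and the error in the position. -/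
lemma mixDist_lampMatrix_le (hP : P ∈ Matrix.rowStochastic ℝ S) {t : ℕ} {ε : ℝ}
    (h : ∀ x, uncovered P (t + 1) {x} x +
      ∑ y, |(Fintype.card S : ℝ)⁻¹ - (P ^ (t + 1)) x y| ≤ ε) [Nonempty S] :
    mixDist (lampMatrix P) (lampDist fun _ => (Fintype.card S : ℝ)⁻¹) (t + 1) ≤ ε := by
  refine ciSup_le fun ⟨f, x⟩ => ?_
  set r : S → ℝ := fun y => (visitMatrix P ^ (t + 1)) ({x}, x) (Finset.univ, y) with hr
  have hrP : ∀ y, r y ≤ (P ^ (t + 1)) x y := fun y => visitMatrix_pow_le hP.1 _ _ _ _ _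
  refine tvDist_le_of_sub_le (d := fun q => ((P ^ (t + 1)) x q.2 - r q.2 +
    |(Fintype.card S : ℝ)⁻¹ - (P ^ (t + 1)) x q.2|) * (2 ^ Fintype.card S)⁻¹) ?_ ?_ ?_ ?_
  · rw [Matrix.sum_row_of_mem_rowStochastic (pow_mem (lampMatrix_mem hP) _), lampDist_uniform, Finset.sum_const,
      Finset.card_univ, nsmul_eq_mul, mul_inv_cancel₀ (by positivity)]
  · intro q
    have := sub_nonneg.2 (hrP q.2)
    positivity
  · rintro ⟨g, y⟩
    have h₁ := le_lampMatrix_pow hP t f g x y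
    have h₂ : (Fintype.card S : ℝ)⁻¹ * (2 ^ Fintype.card S)⁻¹ ≤ ((P ^ (t + 1)) x y +
        |(Fintype.card S : ℝ)⁻¹ - (P ^ (t + 1)) x y|) * (2 ^ Fintype.card S)⁻¹ := by
      gcongr
      linarith [le_abs_self ((Fintype.card S : ℝ)⁻¹ - (P ^ (t + 1)) x y)]
    simp only [lampDist, hr]
    linarith
  · rw [Fintype.sum_prod_type_right]
    refine le_trans (le_of_eq ?_) (h x)
    rw [← sum_pow_sub_visitMatrix_pow, ← Finset.sum_add_distrib]
    refine Finset.sum_congr rfl fun y _ => ?_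
    simp only [Finset.sum_const, Finset.card_univ, nsmul_eq_mul]
    simp [mul_comm, hr]

lemma uncovered_le_of_mixDist_le (hP : P ∈ Matrix.rowStochastic ℝ S) (hs : P.IsSymm) {t : ℕ}
    (ht : mixDist (lampMatrix P) (lampDist fun _ => (Fintype.card S : ℝ)⁻¹) t ≤ 1 / 4) (x : S) :
    uncovered P (t + t) {x} x ≤ 3 / 4 := by
  have : Nonempty S := ⟨x⟩
  rw [lampDist_uniform] at ht
  have hlow := le_pow_of_mixDist_le (lampMatrix_mem hP) (lampMatrix_isSymm hs) ht
  have hr : ∀ y, (Fintype.card S : ℝ)⁻¹ / 4 ≤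
      (visitMatrix P ^ (t + t)) ({x}, x) (Finset.univ, y) := by
    intro y
    have h := hlow (0, x) (1, y)
    -- Time 0 is impossible: the off-diagonal entry would vanish, against the positive lower bound.
    obtain hz | ⟨s, hs'⟩ : t + t = 0 ∨ ∃ s, t + t = s + 1 := by
      cases t + t <;> simp
    · have hne : ((0 : S → ZMod 2), x) ≠ (1, y) := fun h => by
        simpa using congrFun (congrArg Prod.fst h) x
      rw [hz, pow_zero, Matrix.one_apply_ne hne] at h
      have : (0 : ℝ) < (Fintype.card ((S → ZMod 2) × S) : ℝ)⁻¹ / 4 := by positivity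
      linarith
    · rw [hs', lampMatrix_pow_zero_one, ← hs'] at h
      have hcard : (Fintype.card ((S → ZMod 2) × S) : ℝ)⁻¹ / 4 =
          (Fintype.card S : ℝ)⁻¹ / 4 * (2 ^ Fintype.card S)⁻¹ := by
        simp [div_eq_mul_inv]
        ring
      rw [hcard] at h
      exact le_of_mul_le_mul_right h (by positivity)
  rw [← sum_pow_sub_visitMatrix_pow, Finset.sum_sub_distrib,
    Matrix.sum_row_of_mem_rowStochastic (pow_mem hP _)]
  have h₁ := Finset.sum_le_sum fun y (_ : y ∈ Finset.univ) => hr y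
  have h₂ : ∑ _y : S, (Fintype.card S : ℝ)⁻¹ / 4 = 1 / 4 := by
    rw [Finset.sum_const, Finset.card_univ, nsmul_eq_mul]
    field_simp
  linarith

lemma succ_mul_uncovered_le (hP : P ∈ Matrix.rowStochastic ℝ S) {x : S}
    (hsum : Summable fun t => uncovered P t {x} x) (t : ℕ) :
    (t + 1) * uncovered P t {x} x ≤ ∑' s, uncovered P s {x} x := by
  have h := Finset.card_nsmul_le_sum (Finset.range (t + 1)) (fun s => uncovered P s {x} x)
    (uncovered P t {x} x) fun s hs =>
      uncovered_antitone hP {x} x (Nat.lt_succ_iff.1 (Finset.mem_range.1 hs))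
  refine le_trans ?_ (hsum.sum_le_tsum (Finset.range (t + 1))
    fun s _ => uncovered_nonneg hP.1 s _ _)
  simpa using h

lemma exists_mixDist_lampMatrix_le [Nontrivial S] (hP : P ∈ Matrix.rowStochastic ℝ S)
    (hs : P.IsSymm) (hlazy : ∀ x, 1 / 2 ≤ P x x) {C : ℝ}
    (hsum : ∀ x, Summable fun t => uncovered P t {x} x)
    (hC : ∀ x, ∑' t, uncovered P t {x} x ≤ C) :
    ∃ t : ℕ, (t : ℝ) ≤ 18 * C ∧
      mixDist (lampMatrix P) (lampDist fun _ => (Fintype.card S : ℝ)⁻¹) t ≤ 1 / 4 := by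
  -- With two states nothing is covered at time 0. Hence ⌊18C⌋ > 18C - 1 ≥ 17C.
  have hC1 : 1 ≤ C := by
    obtain ⟨x⟩ : Nonempty S := inferInstance
    have h := (succ_mul_uncovered_le hP (hsum x) 0).trans (hC x)
    rw [uncovered_zero, if_neg] at h
    · simpa using h
    · intro h
      obtain ⟨y, hy⟩ := exists_ne x
      exact hy (Finset.mem_singleton.1 (h ▸ Finset.mem_univ y))
  have hlt := Nat.lt_floor_add_one (18 * C)
  have hle := Nat.floor_le (show 0 ≤ 18 * C by linarith)
  obtain ⟨s, hs'⟩ : ∃ s, ⌊18 * C⌋₊ = s + 1 :=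
    Nat.exists_eq_succ_of_ne_zero (Nat.floor_pos.2 (by linarith)).ne'
  rw [hs'] at hlt hle
  refine ⟨s + 1, hle, mixDist_lampMatrix_le hP fun x => ?_⟩
  have h₁ := (succ_mul_uncovered_le hP (hsum x) (s + 1)).trans (hC x)
  have h₂ := mul_sum_abs_pow_sub_sq_le hP hs hlazy hsum hC (s + 1) x
  set T : ℝ := ((s + 1 : ℕ) : ℝ)
  set u := uncovered P (s + 1) {x} x
  set w := ∑ y, |(Fintype.card S : ℝ)⁻¹ - (P ^ (s + 1)) x y|
  have hu0 : 0 ≤ u := uncovered_nonneg hP.1 _ _ _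
  have hw0 : 0 ≤ w := Finset.sum_nonneg fun y _ => abs_nonneg _
  have hu : u ≤ 1 / 18 := by
    by_contra! hu
    nlinarith
  -- From 2Tw² ≤ C and T > 17C, w² ≤ 1/34 < (7/36)²; the budget is 1/18 + 7/36 = 1/4.
  have hw : w ≤ 7 / 36 := by
    by_contra! hw
    have : (7 / 36) ^ 2 < w ^ 2 := by gcongr
    nlinarith
  linarith

end LampMixing

/-! ### Regular graphs: symmetry, uniform stationary law, irreducibility -/

section Graph

variable {V : Type*} [Fintype V] [DecidableEq V] {G : SimpleGraph V} [DecidableRel G.Adj]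

lemma lazyWalk_isSymm {k : ℕ} (hreg : G.IsRegularOfDegree k) : (lazyWalk G).IsSymm := by
  ext x y
  simp only [Matrix.transpose_apply, lazyWalk, hreg.degree_eq, G.adj_comm x y, eq_comm (a := x)]

lemma degreeDist_of_isRegularOfDegree [Nontrivial V] (hconn : G.Connected) {k : ℕ}
    (hreg : G.IsRegularOfDegree k) : degreeDist G = fun _ => (Fintype.card V : ℝ)⁻¹ := by
  funext x
  have hk : (k : ℝ) ≠ 0 := by
    have := (hconn.preconnected.degree_pos_of_nontrivial x).ne'
    rw [hreg.degree_eq] at this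
    exact_mod_cast this
  simp only [degreeDist, hreg.degree_eq, Finset.sum_const, Finset.card_univ, nsmul_eq_mul]
  field_simp

lemma lazyWalk_irreducible [Nontrivial V] (hconn : G.Connected) (x y : V) :
    Relation.ReflTransGen (fun a b => 0 < lazyWalk G a b) x y := by
  refine Relation.ReflTransGen.mono (fun a b hab => ?_) _ _
    ((SimpleGraph.reachable_iff_reflTransGen x y).1 (hconn.preconnected x y))
  have hd : (0 : ℝ) < G.degree a := by
    exact_mod_cast hconn.preconnected.degree_pos_of_nontrivial a
  rw [lazyWalk, if_neg (G.ne_of_adj hab), if_pos hab]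
  positivity

end Graph

end Lamplighter

end

theorem mainTheorem1 {V : Type*} [Fintype V] [DecidableEq V] [Nontrivial V]
    (G : SimpleGraph V) [DecidableRel G.Adj] (hconn : G.Connected)
    (k : ℕ) (hreg : G.IsRegularOfDegree k) :
    Lamplighter.coverTime (Lamplighter.lazyWalk G) (Lamplighter.lazyWalk_mem hconn) ≠ ⊤ ∧
    Lamplighter.IsStationary (Lamplighter.lampMatrix (Lamplighter.lazyWalk G))
      (Lamplighter.lampDist (Lamplighter.degreeDist G)) ∧
    (1 / 12 : ℝ≥0∞) *
        Lamplighter.coverTime (Lamplighter.lazyWalk G) (Lamplighter.lazyWalk_mem hconn) ≤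
      (Lamplighter.mixingTime (Lamplighter.lampMatrix (Lamplighter.lazyWalk G))
        (Lamplighter.lampDist (Lamplighter.degreeDist G)) (1 / 4) : ℝ≥0∞) ∧
    (Lamplighter.mixingTime (Lamplighter.lampMatrix (Lamplighter.lazyWalk G))
        (Lamplighter.lampDist (Lamplighter.degreeDist G)) (1 / 4) : ℝ≥0∞) ≤
      18 * Lamplighter.coverTime (Lamplighter.lazyWalk G) (Lamplighter.lazyWalk_mem hconn) := by
  open Lamplighter in
  have hP := lazyWalk_mem hconn
  have hs := lazyWalk_isSymm hreg
  have hirr := lazyWalk_irreducible hconn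
  have hsum := summable_uncovered hP hirr
  obtain ⟨C, ⟨⟨z, hz⟩, hC⟩, hcov⟩ := exists_isGreatest_coverTime hP hirr
  replace hC : ∀ x, ∑' t, uncovered (lazyWalk G) t {x} x ≤ C := fun x => hC ⟨x, rfl⟩
  obtain ⟨t, htC, ht⟩ := exists_mixDist_lampMatrix_le hP hs (fun x => by simp [lazyWalk]) hsum hC
  obtain ⟨s, hst, hsmix, hseq⟩ := exists_mixingTime_eq ht
  -- `sum_uncovered_le` with N = 2s and q = 3/4; this is stronger than the stated 12.
  have hCs : C ≤ 8 * s := by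
    rw [← hz]
    refine (hsum z).tsum_le_of_sum_range_le fun n => ?_
    refine (sum_uncovered_le hP (by norm_num) (uncovered_le_of_mixDist_le hP hs hsmix) n z).trans ?_
    rw [show (1 : ℝ) - 3 / 4 = 1 / 4 by norm_num]
    push_cast
    linarith
  have hscast : ((s : ℕ∞) : ℝ≥0∞) = ENNReal.ofReal s := by simp
  rw [degreeDist_of_isRegularOfDegree hconn hreg, hcov, hseq, hscast]
  refine ⟨ENNReal.ofReal_ne_top, ?_, ?_, ?_⟩
  · rw [lampDist_uniform]
    exact isStationary_uniform (lampMatrix_mem hP) (lampMatrix_isSymm hs)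
  · rw [show (1 / 12 : ℝ≥0∞) = ENNReal.ofReal (1 / 12) by
      rw [ENNReal.ofReal_div_of_pos (by norm_num)]; simp, ← ENNReal.ofReal_mul (by norm_num)]
    exact ENNReal.ofReal_le_ofReal (by linarith [s.cast_nonneg (α := ℝ)])
  · rw [show (18 : ℝ≥0∞) = ENNReal.ofReal 18 by simp, ← ENNReal.ofReal_mul (by norm_num)]
    have : (s : ℝ) ≤ t := by exact_mod_cast hst
    exact ENNReal.ofReal_le_ofReal (by linarith)
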